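/- Let $p \ge 1$ be a fixed integer. A configuration of the Kadanoff sandpile model KSPM($p$) is an ultimately null sequence $b=(b_i)_{i\ge 0}$ of non-negative integers ($b_i$ is the slope $h_i-h_{i+1}$ between the numbers of grains on columns $i$ and $i+1$). There is a transition from $b$ to a configuration $b'$ by firing column $i$ if $b'_{i-1}=b_{i-1}+p$ (when $i\neq 0$), $b'_i=b_i-(p+1)$, $b'_{i+p}=b_{i+p}+1$ and $b'_j=b_j$ for all other $j$; since $b'_i \ge 0$ is required, this is possible if and only if $b_i>p$. A configuration is stable if no transition is possible from it, and from every configuration exactly one stable configuration can be reached by finitely many (possibly zero) transitions. Let $\pi(N)$ be the stable configuration reached from $(N,0,0,\ldots)$, that is, from $N$ grains stacked on column $0$. Then there is a function $n:\mathbb{N}\to\mathbb{N}$ with $n(N)=O(\log N)$ as $N\to\infty$ (the implied constant may depend on $p$) such that, for every $N \ge 0$, the infinite sequence $\pi(N)_{[n(N),\infty[} = (\pi(N)_{n(N)},\pi(N)_{n(N)+1},\ldots)$ satisfies $$\pi(N)_{[n(N),\infty[} \in (p \cdot \ldots \cdot 2 \cdot 1)^* \,0\, (p \cdot \ldots \cdot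 2 \cdot 1)^*\,0^\omega,$$ where $^*$ denotes finite (possibly empty) repetition and $0^\omega$ is the infinite sequence of zeros. -/

import Mathlib

open Filter Asymptotics

namespace KSPM

/-- Configurations, represented by their slopes: ultimately null sequences of non-negative
integers. -/
abbrev Config : Type := ℕ →₀ ℕ

/-- `Fires p i b b'`: the rule of parameter `p` leads from `b` to `b'` by firing column `i`.
The entry `i - 1` exists only for `i ≠ 0`. As `b'` has entries in `ℕ`, the clause `at_col` says
that `b' i = b i - (p + 1)` and that this is non-negative. -/
structure Fires (p i : ℕ) (b b' : Config) : Prop where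
  left : ∀ j, j + 1 = i → b' j = b j + p
  at_col : b' i + (p + 1) = b i
  right : b' (i + p) = b (i + p) + 1
  other : ∀ j, j + 1 ≠ i → j ≠ i → j ≠ i + p → b' j = b j

/-- One transition, on some column. -/
def Step (p : ℕ) (b b' : Config) : Prop := ∃ i, Fires p i b b'

/-- `b'` is reachable from `b` by finitely many (possibly zero) transitions. -/
def Reachable (p : ℕ) : Config → Config → Prop := Relation.ReflTransGen (Step p)

/-- No transition is possible from `b`. -/
def Stable (p : ℕ) (b : Config) : Prop := ∀ b', ¬ Step p b b'

/-- The initial configuration `(N, 0, 0, …)`. -/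
noncomputable def initial (N : ℕ) : Config := Finsupp.single 0 N

/-- The left-neighbour contribution of a firing at `i`. -/
noncomputable def leftPart (p i : ℕ) : Config := if i = 0 then 0 else Finsupp.single (i - 1) p

theorem fires_iff {p : ℕ} (hp : 0 < p) (i : ℕ) (b b' : Config) :
    Fires p i b b' ↔
      b' + Finsupp.single i (p + 1) = b + Finsupp.single (i + p) 1 + leftPart p i := by
  have key : ∀ j, leftPart p i j = if j + 1 = i then p else 0 := by
    intro j
    unfold leftPart
    split_ifs <;> simp [Finsupp.single_apply] <;> omega
  constructor
  · intro h
    ext j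
    simp only [Finsupp.add_apply, Finsupp.single_apply, key]
    have h1 := h.left j
    have h2 := h.at_col
    have h3 := h.right
    have h4 := h.other j
    by_cases e1 : i = j
    · subst e1; split_ifs <;> omega
    · by_cases e2 : i + p = j
      · subst e2; split_ifs <;> omega
      · split_ifs <;> omega
  · intro h
    have h' : ∀ j, b' j + (if i = j then p + 1 else 0)
        = b j + (if i + p = j then 1 else 0) + (if j + 1 = i then p else 0) := by
      intro j
      have := DFunLike.congr_fun h j
      simpa only [Finsupp.add_apply, Finsupp.single_apply, key] using this
    refine ⟨fun j hj => ?_, ?_, ?_, fun j h1 h2 h3 => ?_⟩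
    · have := h' j; split_ifs at this <;> omega
    · have := h' i; split_ifs at this <;> omega
    · have := h' (i + p); split_ifs at this <;> omega
    · have := h' j; split_ifs at this <;> omega

/-- A column can be fired exactly when its slope exceeds `p`. -/
theorem exists_fires_iff {p : ℕ} (hp : 0 < p) (i : ℕ) (b : Config) :
    (∃ b', Fires p i b b') ↔ p < b i := by
  constructor
  · rintro ⟨b', h⟩
    have := h.at_col
    omega
  · intro h
    refine ⟨b + Finsupp.single (i + p) 1 + leftPart p i - Finsupp.single i (p + 1), ?_⟩
    rw [fires_iff hp]
    refine tsub_add_cancel_of_le ?_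
    refine le_trans ?_ (le_trans le_self_add le_self_add)
    rw [Finsupp.single_le_iff]
    omega

/-- The weighted sum `∑ f i * b i`. -/
noncomputable def wsum (f : ℕ → ℕ) (b : Config) : ℕ := b.sum fun i x => f i * x

theorem wsum_add (f : ℕ → ℕ) (b c : Config) : wsum f (b + c) = wsum f b + wsum f c :=
  Finsupp.sum_add_index' (by simp) (by intros; ring)

theorem wsum_single (f : ℕ → ℕ) (i x : ℕ) : wsum f (Finsupp.single i x) = f i * x :=
  Finsupp.sum_single_index (by simp)

theorem wsum_fires {p : ℕ} (hp : 0 < p) {i : ℕ} {b b' : Config} (h : Fires p i b b') :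
    wsum (fun i => i + 1) b' = wsum (fun i => i + 1) b ∧
      wsum (fun i => i * (i + 1)) b' = wsum (fun i => i * (i + 1)) b + p * (p + 1) := by
  rw [fires_iff hp] at h
  have h1 := congrArg (wsum fun i => i + 1) h
  have h2 := congrArg (wsum fun i => i * (i + 1)) h
  rcases i with _ | k
  · simp only [leftPart, wsum_add, wsum_single, if_true, add_zero] at h1 h2
    constructor <;> linarith
  · simp only [leftPart, wsum_add, wsum_single, Nat.succ_ne_zero, if_false,
      Nat.add_sub_cancel] at h1 h2
    constructor <;> nlinarith

theorem wsum_le (b : Config) :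
    wsum (fun i => i * (i + 1)) b ≤ wsum (fun i => i + 1) b * wsum (fun i => i + 1) b := by
  have hle : ∀ i ∈ b.support, i + 1 ≤ wsum (fun i => i + 1) b := by
    intro i hi
    have h1 : (i + 1) * b i ≤ wsum (fun i => i + 1) b :=
      Finset.single_le_sum (f := fun i => (i + 1) * b i) (fun _ _ => Nat.zero_le _) hi
    have h2 : 0 < b i := Nat.pos_of_ne_zero (Finsupp.mem_support_iff.1 hi)
    nlinarith
  have hmul : wsum (fun i => i + 1) b * wsum (fun i => i + 1) b =
      ∑ i ∈ b.support, (i + 1) * b i * wsum (fun i => i + 1) b := Finset.sum_mul _ _ _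
  rw [hmul]
  refine Finset.sum_le_sum fun i hi => ?_
  have h := hle i hi
  calc i * (i + 1) * b i = (i + 1) * b i * i := by ring
    _ ≤ _ := Nat.mul_le_mul_left _ (by omega)

theorem exists_stable {p : ℕ} (hp : 0 < p) (b : Config) :
    ∃ s, Reachable p b s ∧ Stable p s := by
  induction hm : wsum (fun i => i + 1) b * wsum (fun i => i + 1) b -
    wsum (fun i => i * (i + 1)) b using Nat.strong_induction_on generalizing b with
  | _ m ih =>
    by_cases hs : Stable p b
    · exact ⟨b, Relation.ReflTransGen.refl, hs⟩
    · unfold Stable at hs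
      push Not at hs
      obtain ⟨c, i, hc⟩ := hs
      obtain ⟨h1, h2⟩ := wsum_fires hp hc
      have h3 := wsum_le c
      have h4 : 0 < p * (p + 1) := by positivity
      obtain ⟨s, hs, hst⟩ := ih _ (by rw [← hm, ← h1]; omega) c rfl
      exact ⟨s, Relation.ReflTransGen.head ⟨i, hc⟩ hs, hst⟩

theorem diamond {p : ℕ} (hp : 0 < p) {i j : ℕ} {b c d : Config} (hij : i ≠ j)
    (hc : Fires p i b c) (hd : Fires p j b d) : ∃ e, Fires p j c e ∧ Fires p i d e := by
  have hj : p < c j := by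
    have h1 := hd.at_col
    have h2 := hc.left j
    have h3 := hc.right
    have h4 := hc.other j
    by_cases e : j = i + p
    · subst e; omega
    · omega
  obtain ⟨e, he⟩ := (exists_fires_iff hp j c).2 hj
  refine ⟨e, he, ?_⟩
  rw [fires_iff hp] at *
  refine add_right_cancel (b := Finsupp.single j (p + 1)) ?_
  generalize leftPart p i = li at *
  generalize leftPart p j = lj at *
  calc e + Finsupp.single i (p + 1) + Finsupp.single j (p + 1)
      = e + Finsupp.single j (p + 1) + Finsupp.single i (p + 1) := by abel
    _ = c + Finsupp.single i (p + 1) + (Finsupp.single (j + p) 1 + lj) := by rw [he]; abel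
    _ = b + Finsupp.single (j + p) 1 + lj + (Finsupp.single (i + p) 1 + li) := by rw [hc]; abel
    _ = d + Finsupp.single (i + p) 1 + li + Finsupp.single j (p + 1) := by rw [← hd]; abel

theorem existsUnique_stable {p : ℕ} (hp : 0 < p) (b : Config) :
    ∃! s, Reachable p b s ∧ Stable p s := by
  obtain ⟨s, hs, hst⟩ := exists_stable hp b
  refine ⟨s, ⟨hs, hst⟩, ?_⟩
  rintro t ⟨ht, htt⟩
  have stuck : ∀ {x y}, Stable p x → Relation.ReflTransGen (Step p) x y → y = x := by
    intro x y hx hxy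
    rcases hxy.cases_head with h | ⟨z, hz, -⟩
    · exact h.symm
    · exact absurd hz (hx z)
  obtain ⟨u, hsu, htu⟩ := Relation.church_rosser (r := Step p) (by
    rintro a c d ⟨i, hc⟩ ⟨j, hd⟩
    by_cases hij : i = j
    · subst hij
      rw [fires_iff hp] at hc hd
      have : c = d := add_right_cancel (hc.trans hd.symm)
      exact ⟨c, .refl, this ▸ .refl⟩
    · obtain ⟨e, h1, h2⟩ := diamond hp hij hc hd
      exact ⟨e, .single ⟨j, h1⟩, .single ⟨i, h2⟩⟩) hs ht
  exact (stuck htt htu).symm.trans (stuck hst hsu)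

/-- `π(b)`: the unique stable configuration reachable from `b`. -/
noncomputable def fixedPoint (p : ℕ) (hp : 0 < p) (b : Config) : Config :=
  (existsUnique_stable hp b).choose

theorem fixedPoint_spec (p : ℕ) (hp : 0 < p) (b : Config) :
    Reachable p b (fixedPoint p hp b) ∧ Stable p (fixedPoint p hp b) :=
  (existsUnique_stable hp b).choose_spec.1

/-- The word `p ⋯ 2 1`. -/
def wave (p : ℕ) : List ℕ := (List.range' 1 p).reverse

/-- The language `(p ⋯ 2 1)* 0 (p ⋯ 2 1)*` of finite words over `ℕ`. -/
def waveLanguage (p : ℕ) : Language ℕ :=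
  KStar.kstar ({wave p} : Language ℕ) * ({[0]} : Language ℕ) *
    KStar.kstar ({wave p} : Language ℕ)

/-- The infinite sequence `u` belongs to `L 0^ω`: it is a word of `L` followed by zeros only. -/
def MemThenZeros (L : Language ℕ) (u : ℕ → ℕ) : Prop := ∃ w ∈ L, ∀ i, u i = w.getD i 0

end KSPM

namespace KSPM

/-! Let `a i` be the number of firings of column `i` and `d i = a i - a (i + 1)`. Away from the left
border, counting grains gives `p * d (i + p) + b (i + p) = d i + ... + d (i + p - 1)` with `0 ≤ b ≤
p`: each difference is the mean of the `p` previous ones, lowered by at most 1.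

Averaging contracts. The maximum of a window of `p` differences never grows and, by integrality, its
minimum does not drop unless the window is constant ("flat"). Every `p` steps the spread shrinks by
a factor `1 - 1 / p ^ 2` (`exists_isFlat`). As `a ≤ N ^ 2`, a flat window appears within `O(log N)`
columns.

After a flat window of value `c` the recurrence is rigid (`zero_or_wave`): either the slope is 0 and
the window slides by one, or a whole wave `p ... 2 1` follows and leads to a flat window of value `c
- 1`. At `c = 0` no grain moves any more.

It remains to limit the zeros. The vector `a` is the least one that stabilizes (least action
principle). A zero slope preceded by `p` slopes smaller than `p` would allow one firing to be
removed from each column of an interval (`not_removable`). Hence at most `p` zeros come before the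
first wave, and at most one after it while `c > 0`. -/

/-! ### Firing counts and the least action principle. -/

/-- The slopes obtained from `b₀` by firing each column `i` exactly `a i` times, in `ℤ`. -/
def slopeAfter (p : ℕ) (b₀ a : ℕ → ℕ) (i : ℕ) : ℤ :=
  b₀ i - (p + 1) * a i + p * a (i + 1) + if p ≤ i then (a (i - p) : ℤ) else 0

/-- `a` is a vector of firing counts leading from `b₀` to `b`, it is below every vector that
stabilizes `b₀`, and its entries are controlled by the second moment of the slopes. -/
structure IsOdometer (p : ℕ) (b₀ b : Config) (a : ℕ →₀ ℕ) : Prop where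
  slope : ∀ i, (b i : ℤ) = slopeAfter p b₀ a i
  least : ∀ a' : ℕ → ℕ, (∀ i, slopeAfter p b₀ a' i ≤ p) → ∀ i, a i ≤ a' i
  moment : ∀ i, a i * (p * (p + 1)) ≤ wsum (fun i => i * (i + 1)) b
  mass : wsum (fun i => i + 1) b = wsum (fun i => i + 1) b₀

theorem slopeAfter_add_single (p : ℕ) (hp : 0 < p) (b₀ : ℕ → ℕ) (a : ℕ →₀ ℕ) (k i : ℕ) :
    slopeAfter p b₀ (a + Finsupp.single k 1 : ℕ →₀ ℕ) i = slopeAfter p b₀ a i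
      - (if i = k then (p : ℤ) + 1 else 0) + (if i + 1 = k then (p : ℤ) else 0)
      + (if i = k + p then 1 else 0) := by
  unfold slopeAfter
  simp only [Finsupp.add_apply, Finsupp.single_apply]
  by_cases h1 : i = k
  · subst h1
    have : i ≠ i - p ∨ ¬ p ≤ i := by omega
    rcases this with h | h <;> simp [h, hp.ne'] <;> ring
  · by_cases h2 : i + 1 = k
    · subst h2
      have e1 : i + 1 ≠ i - p := by omega
      have e2 : i ≠ i + 1 + p := by omega
      simp [e1, e2]; ring
    · by_cases h3 : i = k + p
      · subst h3
        have e1 : k ≠ k + p + 1 := by omega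
        simp [e1, hp.ne', h2]; ring
      · have e1 : ¬ (p ≤ i ∧ k = i - p) := by omega
        by_cases hpi : p ≤ i
        · have e2 : k ≠ i - p := by omega
          simp [h1, h2, h3, Ne.symm h1, Ne.symm h2, e2]
        · simp [h1, h2, h3, Ne.symm h1, Ne.symm h2, hpi]

/-- Firing other columns only adds to the slope at `i`; only firings of `i` itself lower it. -/
theorem slopeAfter_le_slopeAfter (p : ℕ) (b₀ a a' : ℕ → ℕ) (h : ∀ i, a i ≤ a' i) (i : ℕ)
    (hi : a i = a' i) : slopeAfter p b₀ a i ≤ slopeAfter p b₀ a' i := by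
  unfold slopeAfter
  rw [hi]
  have h1 : (p : ℤ) * a (i + 1) ≤ p * a' (i + 1) := by
    have := h (i + 1)
    gcongr
  have h2 : (a (i - p) : ℤ) ≤ a' (i - p) := by exact_mod_cast h _
  split_ifs <;> linarith

/-- Leastness survives a firing: if a stabilizing `a'` already agrees with `a` at `k`, its slope
there is at least `b k > p`, which is absurd. Each firing adds exactly `p * (p + 1)` to the second
moment, which gives `moment`. -/
theorem IsOdometer.fires {p : ℕ} (hp : 0 < p) {b₀ b b' : Config} {a : ℕ →₀ ℕ} {k : ℕ}
    (h : IsOdometer p b₀ b a) (hf : Fires p k b b') :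
    IsOdometer p b₀ b' (a + Finsupp.single k 1) where
  slope i := by
    rw [slopeAfter_add_single p hp, ← h.slope]
    have h1 := hf.left i
    have h2 := hf.at_col
    have h3 := hf.right
    have h4 := hf.other i
    by_cases e1 : i = k
    · subst e1
      simp [hp.ne']; omega
    · by_cases e2 : i = k + p
      · subst e2
        have e3 : k + p + 1 ≠ k := by omega
        simp [hp.ne', e3, h3]
      · by_cases e3 : i + 1 = k
        · simp [e1, e2, e3, h1 e3]
        · simp [e1, e2, e3, h4 e3 e1 e2]
  least a' ha' i := by
    have hle := h.least a' ha'
    simp only [Finsupp.add_apply, Finsupp.single_apply]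
    split_ifs with hk
    · subst hk
      by_contra hlt
      have heq : a k = a' k := le_antisymm (hle k) (by omega)
      have h1 := slopeAfter_le_slopeAfter p b₀ a a' hle k heq
      have h2 := h.slope k
      have h3 := ha' k
      have h4 := hf.at_col
      omega
    · exact hle i
  moment i := by
    have h1 := h.moment i
    rw [(wsum_fires hp hf).2, Finsupp.add_apply, add_mul]
    have : Finsupp.single k 1 i ≤ 1 := by
      rw [Finsupp.single_apply]; split_ifs <;> omega
    nlinarith [Nat.mul_le_mul_right (p * (p + 1)) this]
  mass := (wsum_fires hp hf).1.trans h.mass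

theorem exists_isOdometer {p : ℕ} (hp : 0 < p) {b₀ b : Config} (h : Reachable p b₀ b) :
    ∃ a, IsOdometer p b₀ b a := by
  induction h with
  | refl =>
    refine ⟨0, ⟨fun i => by simp [slopeAfter], fun _ _ _ => Nat.zero_le _, fun i => ?_, rfl⟩⟩
    simp
  | tail _ hs ih =>
    obtain ⟨a, ha⟩ := ih
    obtain ⟨k, hk⟩ := hs
    exact ⟨_, ha.fires hp hk⟩

theorem stable_le {p : ℕ} (hp : 0 < p) {b : Config} (h : Stable p b) (i : ℕ) : b i ≤ p := by
  by_contra hlt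
  obtain ⟨b', hb'⟩ := (exists_fires_iff hp i b).2 (not_le.1 hlt)
  exact h b' ⟨i, hb'⟩

/-- The least odometer cannot be lowered by one on an interval `[w, t]`. -/
theorem IsOdometer.not_removable {p : ℕ} {b₀ b : Config} {a : ℕ →₀ ℕ}
    (h : IsOdometer p b₀ b a) (hb : ∀ i, b i ≤ p) {w t : ℕ} (hwt : w + p ≤ t)
    (hw : ∀ i, w ≤ i → i < w + p → b i < p) (ht : b t = 0) :
    ∃ i, w ≤ i ∧ i ≤ t ∧ a i = 0 := by
  by_contra hpos
  push Not at hpos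
  -- The lowered vector still stabilizes: slopes gain 1 on `[w, w + p)`, nothing on `[w + p, t)`,
  -- and `p` at `t`, where the slope was 0; outside `[w, t]` they do not increase.
  have key := h.least (fun i => if w ≤ i ∧ i ≤ t then a i - 1 else a i) ?_ w
  · have := hpos w le_rfl (by omega)
    simp only [le_refl, true_and] at key
    rw [if_pos (by omega)] at key
    omega
  · intro i
    have hsl := h.slope i
    have hbi := hb i
    have hwi := hw i
    have ha' : ∀ j, (((if w ≤ j ∧ j ≤ t then a j - 1 else a j : ℕ)) : ℤ)
        = a j - if w ≤ j ∧ j ≤ t then 1 else 0 := by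
      intro j
      by_cases hj : w ≤ j ∧ j ≤ t
      · have := hpos j hj.1 hj.2
        rw [if_pos hj, if_pos hj]; omega
      · rw [if_neg hj, if_neg hj]; simp
    unfold slopeAfter at hsl ⊢
    simp only [ha', mul_sub]
    by_cases hpi : p ≤ i
    · simp only [hpi, if_true] at hsl ⊢
      by_cases e : i = t
      · subst e
        split_ifs <;> simp <;> omega
      · split_ifs <;> simp <;> omega
    · simp only [hpi, if_false] at hsl ⊢
      split_ifs <;> simp <;> omega

/-! ### Contraction of the differences of firing counts. -/

/-- A sequence `a` of firing counts with slopes `b` away from the left border. -/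
structure IsStableTail (p : ℕ) (a : ℕ → ℤ) (b : ℕ → ℕ) : Prop where
  rec_eq : ∀ i, (p : ℤ) * (a (i + p) - a (i + p + 1)) + b (i + p) = a i - a (i + p)
  le : ∀ i, b i ≤ p
  nonneg : ∀ i, 0 ≤ a i
  eventually_zero : ∃ n, ∀ i, n ≤ i → a i = 0

/-- The `p` differences of `a` from index `t` on are all equal to `c`. -/
def IsFlat (p : ℕ) (a : ℕ → ℤ) (t : ℕ) (c : ℤ) : Prop := ∀ j < p, a (t + j) - a (t + j + 1) = c

theorem sum_sub_succ (a : ℕ → ℤ) (i n : ℕ) :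
    ∑ j ∈ Finset.range n, (a (i + j) - a (i + j + 1)) = a i - a (i + n) := by
  induction n with
  | zero => simp
  | succ n ih => rw [Finset.sum_range_succ, ih, ← add_assoc]; ring

namespace IsStableTail

variable {p : ℕ} {a : ℕ → ℤ} {b : ℕ → ℕ}

theorem sum_eq (h : IsStableTail p a b) (i : ℕ) :
    (p : ℤ) * (a (i + p) - a (i + p + 1)) + b (i + p)
      = ∑ j ∈ Finset.range p, (a (i + j) - a (i + j + 1)) := by
  rw [h.rec_eq, sum_sub_succ]

/-- A mean of `p` terms at most `M`, one of which is at most `x`, is at most `M - (M - x) / p`;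
subtracting the slope only helps. -/
theorem mul_next_le (h : IsStableTail p a b) {i j : ℕ} {M x : ℤ} (hj : j < p)
    (hM : ∀ k < p, a (i + k) - a (i + k + 1) ≤ M) (hx : a (i + j) - a (i + j + 1) ≤ x) :
    (p : ℤ) * (a (i + p) - a (i + p + 1)) ≤ p * M - (M - x) := by
  have h1 := h.sum_eq i
  have h2 : ∑ k ∈ Finset.range p, (a (i + k) - a (i + k + 1))
      ≤ ∑ k ∈ Finset.range p, (M - if k = j then M - x else 0) := by
    refine Finset.sum_le_sum fun k hk => ?_
    by_cases e : k = j
    · subst e; simpa using hx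
    · simpa [e] using hM k (Finset.mem_range.1 hk)
  rw [Finset.sum_sub_distrib (fun _ => M), Finset.sum_ite_eq' (Finset.range p) j] at h2
  simp only [Finset.sum_const, Finset.card_range, nsmul_eq_mul, Finset.mem_range, hj,
    if_true] at h2
  have h3 : (0 : ℤ) ≤ b (i + p) := by positivity
  linarith

theorem diff_le (h : IsStableTail p a b) (hp : 0 < p) {i : ℕ} {M : ℤ}
    (hM : ∀ k < p, a (i + k) - a (i + k + 1) ≤ M) (k : ℕ) : a (i + k) - a (i + k + 1) ≤ M := by
  induction k using Nat.strong_induction_on with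
  | _ k ih =>
    by_cases hk : k < p
    · exact hM k hk
    · obtain ⟨l, rfl⟩ := Nat.exists_eq_add_of_le' (not_lt.1 hk)
      have h1 := h.mul_next_le (i := i + l) (j := 0) (M := M) (x := M) hp
        (fun m hm => by simpa only [add_assoc] using ih (l + m) (by omega))
        (by simpa only [add_assoc] using ih (l + 0) (by omega))
      have hp' : (0 : ℤ) < p := by exact_mod_cast hp
      rw [← add_assoc]
      exact le_of_mul_le_mul_left (by linarith) hp'

/-- In a non-constant window the sum strictly exceeds `p * m`. Subtracting a slope of at most `p`
leaves more than `p * (m - 1)`, so the next integer difference is at least `m`. -/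
theorem le_next (h : IsStableTail p a b) (hp : 0 < p) {i : ℕ} {m : ℤ}
    (hm : ∀ k < p, m ≤ a (i + k) - a (i + k + 1)) (hf : ∀ c, ¬ IsFlat p a i c) :
    m ≤ a (i + p) - a (i + p + 1) := by
  have h1 := h.sum_eq i
  have h2 : ∑ k ∈ Finset.range p, m < ∑ k ∈ Finset.range p, (a (i + k) - a (i + k + 1)) := by
    refine Finset.sum_lt_sum (fun k hk => hm k (Finset.mem_range.1 hk)) ?_
    by_contra hcon
    push Not at hcon
    exact hf m fun k hk => le_antisymm (hcon k (Finset.mem_range.2 hk)) (hm k hk)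
  simp only [Finset.sum_const, Finset.card_range, nsmul_eq_mul] at h2
  have h3 : (b (i + p) : ℤ) ≤ p := by exact_mod_cast h.le _
  have hp' : (0 : ℤ) < p := by exact_mod_cast hp
  by_contra hlt
  push Not at hlt
  have : (p : ℤ) * (a (i + p) - a (i + p + 1)) ≤ p * (m - 1) :=
    mul_le_mul_of_nonneg_left (by linarith [Int.le_sub_one_of_lt hlt]) hp'.le
  linarith

theorem le_diff (h : IsStableTail p a b) (hp : 0 < p) {i n : ℕ} {m : ℤ}
    (hm : ∀ k < p, m ≤ a (i + k) - a (i + k + 1)) (hf : ∀ k < n, ∀ c, ¬ IsFlat p a (i + k) c)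
    (k : ℕ) (hk : k < n + p) : m ≤ a (i + k) - a (i + k + 1) := by
  induction k using Nat.strong_induction_on with
  | _ k ih =>
    by_cases hkp : k < p
    · exact hm k hkp
    · obtain ⟨l, rfl⟩ := Nat.exists_eq_add_of_le' (not_lt.1 hkp)
      rw [← add_assoc]
      exact h.le_next hp (i := i + l)
        (fun j hj => by simpa only [add_assoc] using ih (l + j) (by omega) (by omega))
        (hf l (by omega))

/-- Over `p` steps, the spread of a window of `p` differences shrinks by a factor `1 - 1 / p ^ 2`,
unless a flat window occurs. -/
theorem exists_isFlat (h : IsStableTail p a b) (hp : 0 < p) (n : ℕ) : ∀ i : ℕ,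
    (∀ j < p, ∀ k < p, ((a (i + j) - a (i + j + 1)) - (a (i + k) - a (i + k + 1)))
      * ((p : ℤ) ^ 2 - 1) ^ n < ((p : ℤ) ^ 2) ^ n) →
    ∃ t, i ≤ t ∧ t ≤ i + p * n ∧ ∃ c, IsFlat p a t c := by
  induction n with
  | zero =>
    intro i hi
    refine ⟨i, le_rfl, by simp, a i - a (i + 1), fun j hj => ?_⟩
    have h1 := hi j hj 0 hp
    have h2 := hi 0 hp j hj
    -- A spread smaller than 1 is zero, by integrality.
    simp only [pow_zero, mul_one, add_zero] at h1 h2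
    omega
  | succ n ih =>
    intro i hi
    by_cases hflat : ∃ k < p, ∃ c, IsFlat p a (i + k) c
    · obtain ⟨k, hk, hc⟩ := hflat
      exact ⟨i + k, by omega, by nlinarith, hc⟩
    push Not at hflat
    have hne : (Finset.range p).Nonempty := ⟨0, Finset.mem_range.2 hp⟩
    obtain ⟨j₁, hj₁, hmax⟩ := Finset.exists_max_image (Finset.range p)
      (fun k => a (i + k) - a (i + k + 1)) hne
    obtain ⟨j₀, hj₀, hmin⟩ := Finset.exists_min_image (Finset.range p)
      (fun k => a (i + k) - a (i + k + 1)) hne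
    have hE := hi j₁ (Finset.mem_range.1 hj₁) j₀ (Finset.mem_range.1 hj₀)
    simp only [Finset.mem_range] at hj₀ hj₁ hmax hmin
    set M := a (i + j₁) - a (i + j₁ + 1) with hMdef
    set m := a (i + j₀) - a (i + j₀ + 1) with hmdef
    have hMm : m ≤ M := hmin j₁ hj₁
    have hp1 : (1 : ℤ) ≤ p := by exact_mod_cast hp
    have hlow := h.le_diff hp hmin hflat
    have hup := h.diff_le hp hmax
    have hup' : ∀ k l, a (i + k + l) - a (i + k + l + 1) ≤ M := fun k l => by
      simpa only [add_assoc] using hup (k + l)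
    -- For `k ≤ j₀` the averaged window contains the minimum, at `i + j₀`.
    have near : ∀ k, k ≤ j₀ →
        (p : ℤ) * (a (i + k + p) - a (i + k + p + 1)) ≤ p * M - (M - m) := by
      intro k hk
      refine h.mul_next_le (i := i + k) (j := j₀ - k) (by omega) (fun l _ => hup' k l) ?_
      rw [show i + k + (j₀ - k) = i + j₀ by omega]
    -- For `k > j₀` the window misses the minimum but contains `i + j₀ + p`, already lowered by `(M
    -- - m) / p`; averaging a second time gives the factor `1 / p ^ 2`.
    have far : ∀ k < p, (p : ℤ) ^ 2 * (a (i + k + p) - a (i + k + p + 1))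
        ≤ (p : ℤ) ^ 2 * M - (M - m) := by
      intro k hk
      rcases le_or_gt k j₀ with hle | hgt
      · have := near k hle
        nlinarith
      · have h1 := near j₀ le_rfl
        have h2 := h.mul_next_le (i := i + k) (j := j₀ + p - k) (M := M) (by omega)
          (fun l _ => hup' k l)
          (by rw [show i + k + (j₀ + p - k) = i + j₀ + p by omega])
        nlinarith
    obtain ⟨t, ht1, ht2, hc⟩ := ih (i + p) (by
      intro j hj k hk
      have h1 := far j hj
      have h2 := hlow (p + k) (by omega)
      rw [show i + j + p = i + p + j by omega] at h1
      rw [← add_assoc] at h2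
      set x := a (i + p + j) - a (i + p + j + 1)
      set y := a (i + p + k) - a (i + p + k + 1)
      have hq : (0 : ℤ) ≤ (p : ℤ) ^ 2 - 1 := by nlinarith
      have h3 : (p : ℤ) ^ 2 * (x - y) ≤ ((p : ℤ) ^ 2 - 1) * (M - m) := by nlinarith
      have h4 := mul_le_mul_of_nonneg_right h3 (pow_nonneg hq n)
      have hpp : (0 : ℤ) < (p : ℤ) ^ 2 := by positivity
      refine lt_of_mul_lt_mul_left ?_ hpp.le
      calc (p : ℤ) ^ 2 * ((x - y) * ((p : ℤ) ^ 2 - 1) ^ n)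
          ≤ (M - m) * ((p : ℤ) ^ 2 - 1) ^ (n + 1) := by
            rw [pow_succ _ n]; linarith
        _ < (p : ℤ) ^ 2 * ((p : ℤ) ^ 2) ^ n := by rw [← pow_succ']; exact hE)
    exact ⟨t, by omega, by rw [mul_add]; omega, hc⟩

/-! ### What follows a flat window. -/

theorem flat_sub (t : ℕ) (c : ℤ) (hf : IsFlat p a t c) : a t - a (t + p) = p * c := by
  rw [← sum_sub_succ, Finset.sum_congr rfl fun j hj => hf j (Finset.mem_range.1 hj)]
  simp

/-- After a flat window the slope is a multiple of `p`, hence 0 or `p`. If it is `p`, the window sum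
is `p * c - j` after `j` further steps, and for `0 < j < p` the bounds on the slope force the
difference `c - 1` and the slope `p - j`. -/
theorem zero_or_wave (h : IsStableTail p a b) (hp : 0 < p) {t : ℕ} {c : ℤ}
    (hf : IsFlat p a t c) :
    (b (t + p) = 0 ∧ IsFlat p a (t + 1) c) ∨
      (IsFlat p a (t + p) (c - 1) ∧ ∀ j < p, b (t + p + j) = p - j) := by
  have hp' : (0 : ℤ) < p := by exact_mod_cast hp
  have h1 := h.rec_eq t
  rw [flat_sub t c hf] at h1
  have hb : (b (t + p) : ℤ) ≤ p := by exact_mod_cast h.le _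
  have hb0 : (0 : ℤ) ≤ b (t + p) := by positivity
  have h2 : a (t + p) - a (t + p + 1) = c ∨ a (t + p) - a (t + p + 1) = c - 1 := by
    have u : a (t + p) - a (t + p + 1) ≤ c :=
      le_of_mul_le_mul_left (by linarith) hp'
    have l : c - 1 ≤ a (t + p) - a (t + p + 1) :=
      le_of_mul_le_mul_left (by linarith) hp'
    omega
  rcases h2 with h2 | h2
  · left
    rw [h2] at h1
    refine ⟨by omega, fun j hj => ?_⟩
    by_cases e : j + 1 = p
    · rw [show t + 1 + j = t + p by omega, h2]
    · rw [show t + 1 + j = t + (j + 1) by omega]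
      exact hf _ (by omega)
  · right
    have key : ∀ j < p, a (t + j) - a (t + p + j) = p * c - j ∧
        a (t + p + j) - a (t + p + j + 1) = c - 1 ∧ b (t + p + j) = p - j := by
      intro j
      induction j with
      | zero =>
        intro _
        refine ⟨by simpa using flat_sub t c hf, h2, ?_⟩
        rw [h2] at h1
        have : (b (t + p) : ℤ) = p := by linarith
        simpa using this
      | succ j ih =>
        intro hj
        obtain ⟨e1, e2, -⟩ := ih (by omega)
        have e3 := hf j (by omega)
        have s : a (t + (j + 1)) - a (t + p + (j + 1)) = p * c - (j + 1 : ℕ) := by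
          push_cast
          simp only [← add_assoc]
          linarith
        have r := h.rec_eq (t + (j + 1))
        rw [show t + (j + 1) + p = t + p + (j + 1) by omega, s] at r
        have r1 : (b (t + p + (j + 1)) : ℤ) ≤ p := by exact_mod_cast h.le _
        have r0 : (0 : ℤ) ≤ b (t + p + (j + 1)) := by positivity
        have hjp : ((j + 1 : ℕ) : ℤ) < p := by exact_mod_cast hj
        have hj0 : (0 : ℤ) < ((j + 1 : ℕ) : ℤ) := by positivity
        have u : a (t + p + (j + 1)) - a (t + p + (j + 1) + 1) < c :=
          lt_of_mul_lt_mul_left (by linarith) hp'.le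
        have l : c - 2 < a (t + p + (j + 1)) - a (t + p + (j + 1) + 1) :=
          lt_of_mul_lt_mul_left (by linarith) hp'.le
        have e : a (t + p + (j + 1)) - a (t + p + (j + 1) + 1) = c - 1 := by omega
        refine ⟨s, e, ?_⟩
        rw [e] at r
        have : (b (t + p + (j + 1)) : ℤ) = p - (j + 1 : ℕ) := by linarith
        omega
    exact ⟨fun j hj => (key j hj).2.1, fun j hj => (key j hj).2.2⟩

/-- All later differences are nonpositive, so `a` is nondecreasing from `t` on; being nonnegative
and ultimately null, it vanishes. -/
theorem eq_zero_of_flat (h : IsStableTail p a b) (hp : 0 < p) {t : ℕ} {c : ℤ} (hc : c ≤ 0)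
    (hf : IsFlat p a t c) (k : ℕ) : a (t + k) = 0 := by
  have hle := h.diff_le hp (i := t) (M := 0) fun k hk => (hf k hk).le.trans hc
  obtain ⟨n, hn⟩ := h.eventually_zero
  have mono : Monotone fun k => a (t + k) :=
    monotone_nat_of_le_succ fun k => by
      have := hle k
      rw [← add_assoc]
      linarith
  have h1 : a (t + k) ≤ a (t + (k + n)) := mono (by omega)
  rw [hn (t + (k + n)) (by omega)] at h1
  exact le_antisymm h1 (h.nonneg _)

theorem slope_eq_zero_of_flat (h : IsStableTail p a b) (hp : 0 < p) {t : ℕ}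
    (hf : IsFlat p a t 0) (k : ℕ) : b (t + p + k) = 0 := by
  have h1 := h.rec_eq (t + k)
  have e := h.eq_zero_of_flat hp le_rfl hf
  rw [show t + k + p + 1 = t + (k + p + 1) by omega, show t + k + p = t + (k + p) by omega,
    e, e, e] at h1
  rw [show t + p + k = t + (k + p) by omega]
  simpa using h1

theorem flat_nonneg (h : IsStableTail p a b) (hp : 0 < p) {t : ℕ} {c : ℤ}
    (hf : IsFlat p a t c) : 0 ≤ c := by
  by_contra hc
  have e := h.eq_zero_of_flat hp (not_le.1 hc).le hf
  have := hf 0 hp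
  rw [add_assoc, e, e] at this
  omega

end IsStableTail

/-! ### Words made of waves. -/

theorem wave_length (p : ℕ) : (wave p).length = p := by simp [wave]

theorem wave_getD (p j : ℕ) (hj : j < p) : (wave p).getD j 0 = p - j := by
  have : j < (wave p).length := by rwa [wave_length]
  rw [List.getD_eq_getElem _ _ this]
  simp only [wave, List.getElem_reverse, List.getElem_range', List.length_range']
  omega

theorem getD_append_of_forall {u : ℕ → ℕ} {v w : List ℕ} {l : ℕ} (hl : v.length = l)
    (hv : ∀ i < l, u i = v.getD i 0) (hw : ∀ i, u (l + i) = w.getD i 0) (i : ℕ) :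
    u i = (v ++ w).getD i 0 := by
  rcases lt_or_ge i l with hi | hi
  · rw [List.getD_append _ _ _ _ (by omega), hv i hi]
  · rw [List.getD_append_right _ _ _ _ (by omega), hl, ← hw, Nat.add_sub_cancel' hi]

/-- The finite word made of `m` waves, a zero and `n` waves. -/
def twoWaves (p m n : ℕ) : List ℕ :=
  (List.replicate m (wave p)).flatten ++ ([0] ++ (List.replicate n (wave p)).flatten)

theorem twoWaves_mem (p m n : ℕ) : twoWaves p m n ∈ waveLanguage p := by
  have hk : ∀ m, (List.replicate m (wave p)).flatten ∈ KStar.kstar ({wave p} : Language ℕ) :=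
    fun m => Language.mem_kstar.2 ⟨_, rfl, fun y hy => List.eq_of_mem_replicate hy⟩
  rw [twoWaves, ← List.append_assoc]
  exact Language.append_mem_mul (Language.append_mem_mul (hk m) rfl) (hk n)

theorem eq_wave_append {p : ℕ} {b : ℕ → ℕ} {s : ℕ} {w : List ℕ}
    (h : ∀ j < p, b (s + j) = p - j) (hw : ∀ i, b (s + p + i) = w.getD i 0) (i : ℕ) :
    b (s + i) = (wave p ++ w).getD i 0 :=
  getD_append_of_forall (u := fun i => b (s + i)) (wave_length p)
    (fun i hi => by rw [wave_getD p i hi]; exact h i hi)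
    (fun i => by simpa only [add_assoc] using hw i) i

/-! ### Limiting the number of zeros. -/

/-- A zero slope at a fired column is never preceded by `p` consecutive slopes smaller than `p`,
provided the firing counts do not increase in between. -/
def NoLateZero (p : ℕ) (a : ℕ → ℤ) (b : ℕ → ℕ) : Prop :=
  ∀ w t, w + p ≤ t → (∀ i, w ≤ i → i < w + p → b i < p) →
    (∀ i, w ≤ i → i < t → a (i + 1) ≤ a i) → 0 < a t → b t ≠ 0

namespace IsStableTail

variable {p : ℕ} {a : ℕ → ℤ} {b : ℕ → ℕ}

/-- Once `p` consecutive slopes are smaller than `p`, minimality excludes the zero branch while the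
value of the window is positive; so exactly `c` waves follow, then zeros. -/
theorem waves_of_flat (h : IsStableTail p a b) (hp : 0 < p) (hz : NoLateZero p a b) {w : ℕ}
    (hw : ∀ i, w ≤ i → i < w + p → b i < p) (c : ℕ) : ∀ t, w ≤ t → IsFlat p a t c →
    (∀ i, w ≤ i → i < t + p → a (i + 1) ≤ a i) →
    ∀ i, b (t + p + i) = ((List.replicate c (wave p)).flatten).getD i 0 := by
  induction c with
  | zero =>
    intro t _ hf _ i
    simpa using h.slope_eq_zero_of_flat hp (by simpa using hf) i
  | succ c ih =>
    intro t hwt hf hmono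
    rw [List.replicate_succ, List.flatten_cons]
    rcases h.zero_or_wave hp hf with ⟨h0, hf'⟩ | ⟨hf', hwave⟩
    · refine absurd h0 (hz w (t + p) (by omega) hw hmono ?_)
      -- The last difference of the shifted window is `c + 1 > 0`, so column `t + p` has fired.
      have h1 := hf' (p - 1) (by omega)
      rw [show t + 1 + (p - 1) = t + p by omega] at h1
      have h2 := h.nonneg (t + p + 1)
      push_cast at h1
      omega
    · refine eq_wave_append hwave ?_
      have hf'' : IsFlat p a (t + p) c := by simpa using hf'
      refine ih (t + p) (by omega) hf'' fun i hi1 hi2 => ?_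
      by_cases hi : i < t + p
      · exact hmono i hi1 hi
      · have := hf'' (i - (t + p)) (by omega)
        rw [Nat.add_sub_cancel' (not_lt.1 hi)] at this
        omega

/-- Just after a wave, one zero is still possible, since the slope `p` that opens the wave blocks
the removal argument until then. -/
theorem twoWaves_of_wave (h : IsStableTail p a b) (hp : 0 < p) (hz : NoLateZero p a b) (c : ℕ) :
    ∀ t, IsFlat p a t c → (∀ j < p, b (t + j) = p - j) →
    ∃ m n, ∀ i, b (t + p + i) = (twoWaves p m n).getD i 0 := by
  induction c with
  | zero =>
    intro t hf _
    refine ⟨0, 0, fun i => ?_⟩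
    rw [h.slope_eq_zero_of_flat hp (by simpa using hf) i]
    rcases i with _ | i <;> simp [twoWaves]
  | succ c ih =>
    intro t hf hb
    rcases h.zero_or_wave hp hf with ⟨h0, hf'⟩ | ⟨hf', hwave⟩
    · refine ⟨0, c + 1, ?_⟩
      -- The slopes from `t + 1` to `t + p` are `p - 1, ..., 1, 0`, all smaller than `p`: no further
      -- zero may occur before the waves run out.
      have hA := h.waves_of_flat hp hz (w := t + 1) (fun i h1 h2 => ?_) (c + 1) (t + 1) le_rfl
        hf' (fun i h1 h2 => ?_)
      · exact getD_append_of_forall (u := fun i => b (t + p + i)) (v := [0]) (l := 1) rfl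
          (fun i hi => by
            obtain rfl : i = 0 := by omega
            simpa using h0)
          (fun i => by
            rw [← hA i]
            exact congrArg b (by omega))
      · by_cases e : i = t + p
        · rw [e, h0]; exact hp
        · have := hb (i - t) (by omega)
          rw [Nat.add_sub_cancel' (by omega)] at this
          omega
      · have := hf' (i - (t + 1)) (by omega)
        rw [Nat.add_sub_cancel' h1] at this
        omega
    · obtain ⟨m, n, hmn⟩ := ih (t + p) (by simpa using hf') hwave
      refine ⟨m + 1, n, ?_⟩
      rw [twoWaves, List.replicate_succ, List.flatten_cons, List.append_assoc]
      exact eq_wave_append hwave hmn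

/-- After a flat window, at most `p` zeros precede the two series of waves. -/
theorem twoWaves_of_flat (h : IsStableTail p a b) (hp : 0 < p) (hz : NoLateZero p a b) {t c : ℕ}
    (hf : IsFlat p a t c) :
    ∃ k ≤ p, ∃ m n, ∀ i, b (t + p + (k + i)) = (twoWaves p m n).getD i 0 := by
  by_cases hall : ∀ k ≤ p, IsFlat p a (t + k) c ∧ ∀ j < k, b (t + p + j) = 0
  -- Here `p` zeros come first and only waves can follow; the mandatory 0 of the word is taken from
  -- the final zeros.
  · refine ⟨p, le_rfl, c, 0, fun i => ?_⟩
    obtain ⟨hf', h0⟩ := hall p le_rfl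
    have hA := h.waves_of_flat hp hz (w := t + p) (fun i h1 h2 => ?_) c (t + p) le_rfl hf'
      (fun i h1 h2 => ?_) i
    · rw [← add_assoc, hA]
      have : ∀ v : List ℕ, v.getD i 0 = (v ++ [0]).getD i 0 := fun v => by
        rcases lt_trichotomy i v.length with hi | hi | hi
        · rw [List.getD_append _ _ _ _ hi]
        · subst hi; simp [List.getD]
        · rw [List.getD_eq_default _ _ hi.le, List.getD_eq_default _ _ (by simpa using hi)]
      simpa [twoWaves] using this _
    · have := h0 (i - (t + p)) (by omega)
      rw [Nat.add_sub_cancel' h1] at this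
      omega
    · have := hf' (i - (t + p)) (by omega)
      rw [Nat.add_sub_cancel' h1] at this
      omega
  · have hex : ∃ k < p, IsFlat p a (t + k) c ∧
        (IsFlat p a (t + k + p) (c - 1) ∧ ∀ j < p, b (t + k + p + j) = p - j) := by
      by_contra hno
      push Not at hno
      refine hall fun k => ?_
      induction k with
      | zero => exact fun _ => ⟨hf, fun j hj => absurd hj (by omega)⟩
      | succ k ih =>
        intro hk
        obtain ⟨h1, h2⟩ := ih (by omega)
        rcases h.zero_or_wave hp h1 with ⟨e, hf'⟩ | ⟨hf', hwave⟩
        · refine ⟨hf', fun j hj => ?_⟩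
          rcases Nat.lt_succ_iff_lt_or_eq.1 hj with hj | rfl
          · exact h2 j hj
          · rw [← e]; exact congrArg b (by omega)
        · obtain ⟨j, hj, hne⟩ := hno k (by omega) h1 hf'
          exact absurd (hwave j hj) hne
    obtain ⟨k, hk, -, hf', hwave⟩ := hex
    have hc := h.flat_nonneg hp hf'
    obtain ⟨m, n, hmn⟩ := h.twoWaves_of_wave hp hz (c - 1) (t + k + p)
      (by rw [Nat.cast_sub (by omega)]; simpa using hf') hwave
    refine ⟨k, hk.le, m + 1, n, fun i => ?_⟩
    rw [twoWaves, List.replicate_succ, List.flatten_cons, List.append_assoc,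
      show t + p + (k + i) = t + k + p + i by omega]
    exact eq_wave_append hwave hmn i

end IsStableTail

/-! ### Logarithmic bounds and conclusion. -/

theorem exists_twoWaves (p : ℕ) (hp : 0 < p) (N K : ℕ)
    (hK : (2 * (N : ℤ) ^ 2) * ((p : ℤ) ^ 2 - 1) ^ K < ((p : ℤ) ^ 2) ^ K) :
    ∃ n ≤ p * (K + 2), MemThenZeros (waveLanguage p)
      (fun i => fixedPoint p hp (initial N) (n + i)) := by
  obtain ⟨hr, hs⟩ := fixedPoint_spec p hp (initial N)
  set b := fixedPoint p hp (initial N)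
  obtain ⟨a, ha⟩ := exists_isOdometer hp hr
  have hb := stable_le hp hs
  have htail : IsStableTail p (fun i => (a i : ℤ)) b := by
    refine ⟨fun i => ?_, hb, fun i => by positivity, ?_⟩
    · have h1 := ha.slope (i + p)
      have h2 : (initial N) (i + p) = 0 := by
        rw [initial, Finsupp.single_apply, if_neg (by omega)]
      simp only [slopeAfter, h2, Nat.le_add_left, if_true, Nat.add_sub_cancel] at h1
      rw [h1]
      push_cast
      ring
    · obtain ⟨n, hn⟩ := a.support.bddAbove
      refine ⟨n + 1, fun i hi => ?_⟩
      by_contra hne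
      have : i ≤ n := hn (Finsupp.mem_support_iff.2 (by simpa using hne))
      omega
  have hz : NoLateZero p (fun i => (a i : ℤ)) b := by
    intro w t hwt hw hmono hpos h0
    obtain ⟨i, h1, h2, h3⟩ := ha.not_removable hb hwt hw h0
    have : ∀ k, i + k ≤ t → (a (i + k) : ℤ) ≤ a i := by
      intro k
      induction k with
      | zero => simp
      | succ k ih =>
        intro hk
        exact (hmono (i + k) (by omega) (by omega)).trans (ih (by omega))
    have h4 := this (t - i) (by omega)
    rw [Nat.add_sub_cancel' h2, h3] at h4
    simp only at hpos
    omega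
  -- The second moment is at most the square of the first, which firing preserves and which equals
  -- `N` initially.
  have hbound : ∀ i, (a i : ℤ) ≤ (N : ℤ) ^ 2 := by
    intro i
    have h1 := ha.moment i
    have h2 := wsum_le b
    rw [ha.mass, initial, wsum_single] at h2
    have h3 : a i ≤ a i * (p * (p + 1)) := Nat.le_mul_of_pos_right _ (by positivity)
    have : a i ≤ N ^ 2 := by nlinarith
    exact_mod_cast this
  obtain ⟨t, -, ht, c, hc⟩ := htail.exists_isFlat hp K 0 (by
    intro j _ k _
    refine lt_of_le_of_lt ?_ hK
    have hp1 : (1 : ℤ) ≤ p := by exact_mod_cast hp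
    refine mul_le_mul_of_nonneg_right ?_ (pow_nonneg (by nlinarith) K)
    have h1 := hbound (0 + j)
    have h2 := hbound (0 + k + 1)
    have h3 : (0 : ℤ) ≤ a (0 + j + 1) := by positivity
    have h4 : (0 : ℤ) ≤ a (0 + k) := by positivity
    linarith)
  lift c to ℕ using htail.flat_nonneg hp hc
  obtain ⟨k, hk, m, n, hmn⟩ := htail.twoWaves_of_flat hp hz hc
  -- The flat window starts at `t ≤ p * K`; its length `p` and the `k ≤ p` leading zeros account for
  -- the extra `2 * p`.
  refine ⟨t + p + k, by nlinarith, twoWaves p m n, twoWaves_mem p m n, fun i => ?_⟩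
  rw [← hmn i, ← add_assoc]

/-- From `1 - x ≤ exp (-x)` with `x = 1 / p ^ 2`. The `+ 1` inside the logarithm makes the
inequality strict and covers `N = 0`. -/
theorem contraction_exponent (p : ℕ) (hp : 0 < p) (N : ℕ) :
    (2 * (N : ℤ) ^ 2) * ((p : ℤ) ^ 2 - 1) ^ ⌈(p : ℝ) ^ 2 * Real.log (2 * N ^ 2 + 1)⌉₊
      < ((p : ℤ) ^ 2) ^ ⌈(p : ℝ) ^ 2 * Real.log (2 * N ^ 2 + 1)⌉₊ := by
  set K := ⌈(p : ℝ) ^ 2 * Real.log (2 * N ^ 2 + 1)⌉₊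
  have hK : (p : ℝ) ^ 2 * Real.log (2 * N ^ 2 + 1) ≤ K := Nat.le_ceil _
  have hp1 : (1 : ℝ) ≤ p := by exact_mod_cast hp
  have hpp : (0 : ℝ) < (p : ℝ) ^ 2 := by positivity
  have hX : (0 : ℝ) < 2 * (N : ℝ) ^ 2 + 1 := by positivity
  have h1 : (1 - 1 / (p : ℝ) ^ 2) ^ K * (2 * (N : ℝ) ^ 2 + 1) ≤ 1 := by
    have h0 : 0 ≤ 1 - 1 / (p : ℝ) ^ 2 := by
      rw [sub_nonneg, div_le_one hpp]; nlinarith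
    have h2 : (1 - 1 / (p : ℝ) ^ 2) ^ K ≤ Real.exp (-(K / (p : ℝ) ^ 2)) := by
      calc (1 - 1 / (p : ℝ) ^ 2) ^ K ≤ (Real.exp (-(1 / (p : ℝ) ^ 2))) ^ K :=
            pow_le_pow_left₀ h0 (Real.one_sub_le_exp_neg _) K
        _ = _ := by rw [← Real.exp_nat_mul]; congr 1; ring
    calc (1 - 1 / (p : ℝ) ^ 2) ^ K * (2 * (N : ℝ) ^ 2 + 1)
        ≤ Real.exp (-(K / (p : ℝ) ^ 2)) * Real.exp (Real.log (2 * (N : ℝ) ^ 2 + 1)) := by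
          rw [Real.exp_log hX]; gcongr
      _ ≤ 1 := by
          rw [← Real.exp_add, Real.exp_le_one_iff]
          have : Real.log (2 * (N : ℝ) ^ 2 + 1) ≤ K / (p : ℝ) ^ 2 := by
            rw [le_div_iff₀ hpp]; linarith
          linarith
  have h2 : ((p : ℝ) ^ 2 - 1) ^ K = (1 - 1 / (p : ℝ) ^ 2) ^ K * ((p : ℝ) ^ 2) ^ K := by
    rw [← mul_pow]; congr 1; field_simp
  have hP : (0 : ℝ) < ((p : ℝ) ^ 2) ^ K := by positivity
  have h3 : 2 * (N : ℝ) ^ 2 * ((p : ℝ) ^ 2 - 1) ^ K < ((p : ℝ) ^ 2) ^ K := by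
    -- The power can vanish, when `p = 1`.
    rcases eq_or_lt_of_le (show (0 : ℝ) ≤ ((p : ℝ) ^ 2 - 1) ^ K from
      pow_nonneg (by nlinarith) K) with e | e
    · rw [← e]; simpa using hP
    · calc 2 * (N : ℝ) ^ 2 * ((p : ℝ) ^ 2 - 1) ^ K
          < (2 * (N : ℝ) ^ 2 + 1) * ((p : ℝ) ^ 2 - 1) ^ K := by gcongr; linarith
        _ = ((1 - 1 / (p : ℝ) ^ 2) ^ K * (2 * (N : ℝ) ^ 2 + 1)) * ((p : ℝ) ^ 2) ^ K := by
          rw [h2]; ring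
        _ ≤ 1 * ((p : ℝ) ^ 2) ^ K := by gcongr
        _ = _ := one_mul _
  exact_mod_cast h3

theorem contraction_exponent_le (p : ℕ) (N : ℕ) (hN : 3 ≤ N) :
    (⌈(p : ℝ) ^ 2 * Real.log (2 * N ^ 2 + 1)⌉₊ : ℝ) ≤ (3 * (p : ℝ) ^ 2 + 1) * Real.log N := by
  have hN' : (3 : ℝ) ≤ N := by exact_mod_cast hN
  have hlog1 : 1 ≤ Real.log N := by
    rw [Real.le_log_iff_exp_le (by linarith)]
    linarith [Real.exp_one_lt_d9]
  have hlog : Real.log (2 * N ^ 2 + 1) ≤ 3 * Real.log N := by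
    have : 3 * Real.log N = Real.log ((N : ℝ) ^ 3) := by rw [Real.log_pow]; norm_num
    rw [this]
    refine Real.log_le_log (by positivity) ?_
    nlinarith [mul_nonneg (sub_nonneg.2 hN') (sq_nonneg (N : ℝ))]
  have h0 : 0 ≤ Real.log (2 * (N : ℝ) ^ 2 + 1) := Real.log_nonneg (by nlinarith)
  have := (Nat.ceil_lt_add_one (show 0 ≤ (p : ℝ) ^ 2 * Real.log (2 * N ^ 2 + 1) by positivity)).le
  nlinarith [mul_le_mul_of_nonneg_left hlog (sq_nonneg (p : ℝ))]

end KSPM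

theorem theorem1 (p : ℕ) (hp : 0 < p) :
    ∃ n : ℕ → ℕ,
      (fun N : ℕ => (n N : ℝ)) =O[atTop] (fun N : ℕ => Real.log (N : ℝ)) ∧
      ∀ N : ℕ, KSPM.MemThenZeros (KSPM.waveLanguage p)
        (fun i => KSPM.fixedPoint p hp (KSPM.initial N) (n N + i)) := by
  choose n hn hmem using fun N =>
    KSPM.exists_twoWaves p hp N _ (KSPM.contraction_exponent p hp N)
  refine ⟨n, ?_, hmem⟩
  refine IsBigO.of_bound ((p : ℝ) * ((3 * (p : ℝ) ^ 2 + 1) + 2)) ?_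
  filter_upwards [eventually_ge_atTop 3] with N hN
  have hN' : (3 : ℝ) ≤ N := by exact_mod_cast hN
  have hlog1 : 1 ≤ Real.log N := by
    rw [Real.le_log_iff_exp_le (by linarith)]
    linarith [Real.exp_one_lt_d9]
  have h1 := KSPM.contraction_exponent_le p N hN
  have h2 : (n N : ℝ) ≤ p * (⌈(p : ℝ) ^ 2 * Real.log (2 * N ^ 2 + 1)⌉₊ + 2) := by
    exact_mod_cast hn N
  rw [Real.norm_of_nonneg (by positivity), Real.norm_of_nonneg (by linarith), mul_assoc]
  refine h2.trans ?_
  gcongr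
  linarith
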